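/- Let $R$ be a commutative ring, not necessarily Noetherian. A class $\mathfrak{T}$ of $R$-modules is a torsion theory if it contains $0$ and is closed under submodules, quotients, extensions and direct limits. It is half-centered if, whenever $N$ is an $R$-module such that $R/\mathfrak{p}\in\mathfrak{T}$ for all $\mathfrak{p}\in\operatorname{Supp}_R N$, then $N\in\mathfrak{T}$. A prime ideal $\mathfrak{p}$ is weakly associated to an $R$-module $L$ if it is minimal over $(0:_R m)$ for some $m\in L$. An $R$-module is weakly Laskerian if each of its quotients has only finitely many weakly associated primes. For an $R$-module $M$, a finite (possibly empty) sequence $x_1,\dots,x_r$ in $R$ is weakly $M$-regular with respect to $\mathfrak{T}$ if $$\bigl((x_1,\dots,x_{i-1})M:_M x_i\bigr)/(x_1,\dots,x_{i-1})M\in\mathfrak{T}\qquad (1\le i\le r).$$ For an ideal $\mathfrak{a}$ of $R$ let $$\mathfrak{T}\text{-}\mathrm{c.grade}_R(\mathfrak{a},M):=\sup\{\ell\ge 0 : \mathfrak{a}\text{ contains a sequence of length }\ell\text{ that is weakly }M\text{-regular with respect to }\mathfrak{T}\}.$$ If $\mathfrak{a}$ is generated by a finite sequence $\underline{y}=y_1,\dots,y_s$,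 let $\mathbb{K}^\bullet(\underline{y};M)=\operatorname{Hom}_R(\mathbb{K}_\bullet(\underline{y}),M)$, where $\mathbb{K}_\bullet(\underline{y})$ is the Koszul complex, and $$\mathfrak{T}\text{-}\mathrm{K.grade}_R(\mathfrak{a},M):=\inf\{i\ge 0 : H^i(\mathbb{K}^\bullet(\underline{y};M))\notin\mathfrak{T}\},\qquad \inf\emptyset=+\infty.$$ **Theorem.** Let $\mathfrak{T}$ be a half-centered torsion theory of $R$-modules, $\mathfrak{a}$ a finitely generated ideal of $R$ and $M$ a weakly Laskerian $R$-module. Then, for every finite generating sequence $\underline{y}$ of $\mathfrak{a}$ used to compute the right-hand side, $$\mathfrak{T}\text{-}\mathrm{c.grade}_R(\mathfrak{a},M)=\mathfrak{T}\text{-}\mathrm{K.grade}_R(\mathfrak{a},M)$$ in $\{0,1,2,\dots\}\cup\{+\infty\}$. -/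

import Mathlib

open CategoryTheory

universe u

noncomputable section

namespace TorsionGrade

/-! ### Torsion theories and half centered Serre classes -/

/-- A torsion theory: a class of `R`-modules closed under submodules, quotients and extensions
(a Serre class) and under colimits of directed systems. -/
structure IsTorsionTheory {R : Type u} [CommRing R]
    (T : ObjectProperty (ModuleCat.{u} R)) : Prop extends T.IsSerreClass where
  closed_directedColimits : ∀ (J : Type u) [Preorder J] [IsDirectedOrder J] [Nonempty J],
    T.IsClosedUnderColimitsOfShape J

/-- A class `T` is half centered if every module `N` such that `R ⧸ p ∈ T` for all `p ∈ Supp N`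
is itself in `T`. -/
def IsHalfCentered {R : Type u} [CommRing R] (T : ObjectProperty (ModuleCat.{u} R)) : Prop :=
  ∀ N : ModuleCat.{u} R,
    (∀ p ∈ Module.support R N, T (ModuleCat.of R (R ⧸ p.asIdeal))) → T N

/-! ### Weakly associated primes and weakly Laskerian modules -/

/-- The primes that are minimal over the annihilator of some element of `M`. -/
def weaklyAssociatedPrimes (R M : Type u) [CommRing R] [AddCommGroup M] [Module R M] :
    Set (Ideal R) :=
  {p | ∃ m : M, p ∈ (Ideal.torsionOf R M m).minimalPrimes}

/-- Every quotient of `M` has only finitely many weakly associated primes. -/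
def IsWeaklyLaskerian (R M : Type u) [CommRing R] [AddCommGroup M] [Module R M] : Prop :=
  ∀ N : Submodule R M, (weaklyAssociatedPrimes R (M ⧸ N)).Finite

/-! ### Weak regular sequences and the classical grade -/

/-- The submodule `(N :_M x) = {m | x • m ∈ N}`. -/
def colonElem {R M : Type u} [CommRing R] [AddCommGroup M] [Module R M]
    (N : Submodule R M) (x : R) : Submodule R M :=
  N.comap (LinearMap.lsmul R M x)

/-- `x₁, …, xᵣ` is weakly `M`-regular with respect to `T`: for each `i` the module
`((x₁, …, xᵢ₋₁)M :_M xᵢ) / (x₁, …, xᵢ₋₁)M` is in `T` (list positions start at `0`). -/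
def IsWeaklyRegularSeq {R : Type u} [CommRing R] (T : ObjectProperty (ModuleCat.{u} R))
    (M : Type u) [AddCommGroup M] [Module R M] (rs : List R) : Prop :=
  ∀ (i : ℕ) (h : i < rs.length),
    let N : Submodule R M := Ideal.ofList (rs.take i) • ⊤
    T (ModuleCat.of R (colonElem N rs[i] ⧸ N.submoduleOf (colonElem N rs[i])))

/-- The supremum of the lengths of the weakly `M`-regular sequences with respect to `T` in `a`.
The empty sequence always counts, so the supremum lies in `ℕ∞`. -/
def classicalGrade {R : Type u} [CommRing R] (T : ObjectProperty (ModuleCat.{u} R))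
    (a : Ideal R) (M : Type u) [AddCommGroup M] [Module R M] : ℕ∞ :=
  sSup {l : ℕ∞ | ∃ rs : List R,
    (∀ x ∈ rs, x ∈ a) ∧ IsWeaklyRegularSeq T M rs ∧ l = (rs.length : ℕ∞)}

/-! ### The Koszul complex and the Koszul grade -/

/-- The linear form `Rˢ → R` with `eᵢ ↦ yᵢ`. -/
def koszulForm {R : Type u} [CommRing R] {s : ℕ} (y : Fin s → R) : (Fin s → R) →ₗ[R] R :=
  Fintype.linearCombination R y

/-- The differential `⋀ⁿ⁺¹ Rˢ → ⋀ⁿ Rˢ` of the Koszul complex,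
`v₀ ∧ ⋯ ∧ vₙ ↦ ∑ᵢ (-1)ⁱ φ(vᵢ) v₀ ∧ ⋯ ∧ v̂ᵢ ∧ ⋯ ∧ vₙ`, where `φ(eᵢ) = yᵢ`. -/
def koszulD {R : Type u} [CommRing R] {s : ℕ} (y : Fin s → R) (n : ℕ) :
    ⋀[R]^(n + 1) (Fin s → R) →ₗ[R] ⋀[R]^n (Fin s → R) :=
  exteriorPower.alternatingMapLinearEquiv
    (AlternatingMap.alternatizeUncurryFin
      ((koszulForm y).smulRight (exteriorPower.ιMulti R n (M := Fin s → R))))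

theorem koszulD_ιMulti {R : Type u} [CommRing R] {s : ℕ} (y : Fin s → R) (n : ℕ)
    (v : Fin (n + 1) → Fin s → R) :
    koszulD y n (exteriorPower.ιMulti R (n + 1) v) =
      ∑ i : Fin (n + 1), (-1) ^ (i : ℕ) •
        (koszulForm y (v i) • exteriorPower.ιMulti R n (i.removeNth v)) := by
  simp [koszulD, exteriorPower.alternatingMapLinearEquiv_apply_ιMulti,
    AlternatingMap.alternatizeUncurryFin_apply]

theorem koszulD_comp_koszulD {R : Type u} [CommRing R] {s : ℕ} (y : Fin s → R) (n : ℕ) :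
    koszulD y n ∘ₗ koszulD y (n + 1) = 0 := by
  apply exteriorPower.linearMap_ext
  have h := AlternatingMap.alternatizeUncurryFin_alternatizeUncurryFinLM_comp_of_symmetric
    (f := (koszulForm y).smulRight
      ((koszulForm y).smulRight (exteriorPower.ιMulti R n (M := Fin s → R))))
    (fun x z => by ext v; simp [smul_smul, mul_comm])
  ext1 v
  have hv := congrArg (fun g => g v) h
  simp only [AlternatingMap.alternatizeUncurryFin_apply] at hv
  simp only [LinearMap.compAlternatingMap_apply, LinearMap.comp_apply, koszulD_ιMulti, map_sum,
    map_zsmul, map_smul, LinearMap.zero_apply]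
  simpa [koszulD_ιMulti, AlternatingMap.alternatizeUncurryFin_apply] using hv

/-- The Koszul complex `K_•(y)`. -/
def koszulComplex {R : Type u} [CommRing R] {s : ℕ} (y : Fin s → R) :
    ChainComplex (ModuleCat.{u} R) ℕ :=
  ChainComplex.of (fun n => ModuleCat.of R (⋀[R]^n (Fin s → R)))
    (fun n => ModuleCat.ofHom (koszulD y n))
    (fun n => by rw [← ModuleCat.ofHom_comp, koszulD_comp_koszulD]; rfl)

/-- The cochain complex `K^•(y; M) = Hom_R(K_•(y), M)`, whose differential is precomposition with
the differential of `K_•(y)`. -/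
def koszulCochainComplex {R : Type u} [CommRing R] {s : ℕ} (y : Fin s → R)
    (M : Type u) [AddCommGroup M] [Module R M] : CochainComplex (ModuleCat.{u} R) ℕ :=
  CochainComplex.of (fun n => ModuleCat.of R ((koszulComplex y).X n →ₗ[R] M))
    (fun n => ModuleCat.ofHom (LinearMap.lcomp R M ((koszulComplex y).d (n + 1) n).hom))
    (fun n => by
      rw [← ModuleCat.ofHom_comp]
      ext f : 2
      change (f ∘ₗ ((koszulComplex y).d (n + 1) n).hom) ∘ₗ
        ((koszulComplex y).d (n + 1 + 1) (n + 1)).hom = 0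
      rw [LinearMap.comp_assoc, ← ModuleCat.hom_comp, HomologicalComplex.d_comp_d]
      simp)

/-- The Koszul grade, computed from the finite sequence `y`: the infimum of the `i` with
`Hⁱ(K^•(y; M)) ∉ T`, equal to `⊤` if there is no such `i`. -/
def koszulGrade {R : Type u} [CommRing R] (T : ObjectProperty (ModuleCat.{u} R))
    {s : ℕ} (y : Fin s → R) (M : Type u) [AddCommGroup M] [Module R M] : ℕ∞ :=
  sInf {l : ℕ∞ | ∃ i : ℕ, ¬ T ((koszulCochainComplex y M).homology i) ∧ l = (i : ℕ∞)}

end TorsionGrade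

end

/-! Multiplication by an element `x` of the ideal generated by `y` is null-homotopic on `K^•(y; M)`
and factors as `M → xM → M`. If `(0 :_M x) ∈ T`, then modulo `T` the first map induces isomorphisms
on cohomology, hence the second induces zero; so the long exact sequence of
`0 → xM → M → M ⧸ xM → 0` breaks up and the Koszul grade of `M ⧸ xM` is one less than that of `M`.
A weakly regular sequence thus lowers the grade by exactly its length. Conversely, if
`H⁰(K^•(y; M)) = (0 :_M y)` is in `T`, then no weakly associated prime `p` of `M` with `R ⧸ p ∉ T`
contains `y`; when these primes are finitely many, prime avoidance gives an `x` in the ideal outside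
all of them, and half-centredness yields `(0 :_M x) ∈ T`. -/

namespace TorsionGrade

section Koszul

variable {R : Type u} [CommRing R]

/-- Left exterior multiplication `w ↦ e ∧ w`; precomposition with it is the homotopy showing that
the elements of `(y)` act as zero on Koszul cohomology. -/
noncomputable def wedgeLeft {V : Type*} [AddCommGroup V] [Module R V] (e : V) (n : ℕ) :
    ⋀[R]^n V →ₗ[R] ⋀[R]^(n + 1) V :=
  exteriorPower.alternatingMapLinearEquiv ((exteriorPower.ιMulti R (n + 1)).curryLeft e)

theorem wedgeLeft_ιMulti {V : Type*} [AddCommGroup V] [Module R V] (e : V) (n : ℕ)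
    (v : Fin n → V) :
    wedgeLeft e n (exteriorPower.ιMulti R n v) =
      exteriorPower.ιMulti R (n + 1) (Matrix.vecCons e v) := by
  simp [wedgeLeft, exteriorPower.alternatingMapLinearEquiv_apply_ιMulti]

variable {s : ℕ} (y : Fin s → R)

theorem koszulD_comp_wedgeLeft_zero (e : Fin s → R) :
    koszulD y 0 ∘ₗ wedgeLeft e 0 = koszulForm y e • LinearMap.id := by
  apply exteriorPower.linearMap_ext
  ext1 v
  simp only [LinearMap.compAlternatingMap_apply, LinearMap.comp_apply, wedgeLeft_ιMulti,
    koszulD_ιMulti, LinearMap.smul_apply, LinearMap.id_apply]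
  rw [Fin.sum_univ_one]
  simp [Matrix.vecCons]

theorem koszulD_comp_wedgeLeft_succ (e : Fin s → R) (n : ℕ) :
    koszulD y (n + 1) ∘ₗ wedgeLeft e (n + 1) + wedgeLeft e n ∘ₗ koszulD y n =
      koszulForm y e • LinearMap.id := by
  apply exteriorPower.linearMap_ext
  ext1 v
  simp only [LinearMap.compAlternatingMap_apply, LinearMap.comp_apply, wedgeLeft_ιMulti,
    koszulD_ιMulti, LinearMap.smul_apply, LinearMap.id_apply, LinearMap.add_apply, map_sum,
    map_zsmul, map_smul]
  have removeNth_succ (i : Fin (n + 1)) :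
      i.succ.removeNth (Matrix.vecCons e v) = Matrix.vecCons e (i.removeNth v) := by
    ext1 j
    cases j using Fin.cases <;> simp [Fin.removeNth_apply]
  rw [Fin.sum_univ_succ, add_assoc, ← Finset.sum_add_distrib, Finset.sum_eq_zero, add_zero]
  · simp [Matrix.vecCons]
  · intro i _
    rw [removeNth_succ]
    simp [pow_succ]

theorem koszulCochainComplex_d (M : Type u) [AddCommGroup M] [Module R M] (n : ℕ) :
    (koszulCochainComplex y M).d n (n + 1) =
      ModuleCat.ofHom (LinearMap.lcomp R M (koszulD y n)) := by
  have d_koszulComplex : (koszulComplex y).d (n + 1) n = ModuleCat.ofHom (koszulD y n) :=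
    ChainComplex.of_d (fun n => ModuleCat.of R (⋀[R]^n (Fin s → R)))
      (fun n => ModuleCat.ofHom (koszulD y n)) n
  refine (CochainComplex.of_d (fun n => ModuleCat.of R ((koszulComplex y).X n →ₗ[R] M))
    (fun n => ModuleCat.ofHom (LinearMap.lcomp R M ((koszulComplex y).d (n + 1) n).hom)) n).trans ?_
  rw [d_koszulComplex]
  rfl

variable {M N : Type u} [AddCommGroup M] [Module R M] [AddCommGroup N] [Module R N]

/-- The map `K^•(y; M) ⟶ K^•(y; N)` induced by `f : M → N`. -/
noncomputable def koszulMap (f : M →ₗ[R] N) :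
    koszulCochainComplex y M ⟶ koszulCochainComplex y N where
  f n := ModuleCat.ofHom (LinearMap.compRight R (M := ⋀[R]^n (Fin s → R)) f)
  comm' i j hij := by
    obtain rfl : i + 1 = j := hij
    rw [koszulCochainComplex_d, koszulCochainComplex_d]
    rfl

/-- The Koszul cochain complex `K^•(y; M)` as a functor of `M`. -/
noncomputable def koszulFunctor : ModuleCat.{u} R ⥤ CochainComplex (ModuleCat.{u} R) ℕ where
  obj M := koszulCochainComplex y M
  map f := koszulMap y f.hom

instance : (koszulFunctor y).PreservesZeroMorphisms where
  map_zero _ _ := by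
    ext n : 2
    ext f
    exact LinearMap.zero_comp f

theorem shortExact_map_koszulFunctor {S : ShortComplex (ModuleCat.{u} R)} (hS : S.ShortExact) :
    (S.map (koszulFunctor y)).ShortExact := by
  have := hS.mono_f
  refine HomologicalComplex.shortExact_of_degreewise_shortExact _ fun n =>
    { exact := ?_, mono_f := ?_, epi_g := ?_ }
  · rw [ShortComplex.ShortExact.moduleCat_exact_iff_function_exact]
    intro (b : ⋀[R]^n (Fin s → R) →ₗ[R] S.X₂)
    constructor
    · intro (hb : S.g.hom ∘ₗ b = 0)
      have hb' : ModuleCat.ofHom b ≫ S.g = 0 := ModuleCat.hom_ext hb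
      exact ⟨(hS.exact.lift _ hb').hom, congrArg ModuleCat.Hom.hom (hS.exact.lift_f _ hb')⟩
    · rintro ⟨(a : ⋀[R]^n (Fin s → R) →ₗ[R] S.X₁), rfl⟩
      exact LinearMap.ext fun w => LinearMap.congr_fun (congrArg ModuleCat.Hom.hom S.zero) (a w)
  · rw [ModuleCat.mono_iff_injective]
    intro a b hab
    exact LinearMap.ext fun w => hS.moduleCat_injective_f (LinearMap.congr_fun hab w)
  · rw [ModuleCat.epi_iff_surjective]
    intro (b : ⋀[R]^n (Fin s → R) →ₗ[R] S.X₃)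
    exact Module.projective_lifting_property S.g.hom b hS.moduleCat_surjective_g

/-- The null homotopy of multiplication by `koszulForm y e` on `K^•(y; M)` given by precomposition
with `wedgeLeft e`. -/
noncomputable def koszulHomotopy (e : Fin s → R) :
    Homotopy (koszulMap y (LinearMap.lsmul R M (koszulForm y e))) 0 :=
  let h (i j : ℕ) (hij : (ComplexShape.up ℕ).Rel j i) :
      (koszulCochainComplex y M).X i ⟶ (koszulCochainComplex y M).X j :=
    eqToHom (by rw [show i = j + 1 from (Eq.symm hij)]; rfl) ≫
      ModuleCat.ofHom (LinearMap.lcomp R M (wedgeLeft e j))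
  (Homotopy.ofEq (by
    ext n (f : ⋀[R]^n (Fin s → R) →ₗ[R] M) : 3
    refine LinearMap.ext fun w => ?_
    cases n with
    | zero =>
      rw [Homotopy.nullHomotopicMap'_f_of_not_rel_right (k₁ := 0) (k₀ := 1) rfl
        (by simp), koszulCochainComplex_d]
      have := LinearMap.congr_fun (koszulD_comp_wedgeLeft_zero y e) w
      exact ((congrArg f this).trans (map_smul f _ w)).symm
    | succ n =>
      rw [Homotopy.nullHomotopicMap'_f (k₂ := n) (k₁ := n + 1) (k₀ := n + 2) rfl rfl,
        koszulCochainComplex_d, koszulCochainComplex_d]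
      have := LinearMap.congr_fun (koszulD_comp_wedgeLeft_succ y e n) w
      exact ((map_add f _ _).symm.trans ((congrArg f this).trans (map_smul f _ w))).symm)).trans
    (Homotopy.nullHomotopy' h)

theorem homologyMap_koszulMap_lsmul {x : R} (hx : x ∈ Ideal.span (Set.range y)) (i : ℕ) :
    HomologicalComplex.homologyMap (koszulMap y (LinearMap.lsmul R M x)) i = 0 := by
  obtain ⟨e, rfl⟩ : x ∈ LinearMap.range (koszulForm y) := by
    rwa [koszulForm, Fintype.range_linearCombination]
  rw [(koszulHomotopy y e).homologyMap_eq, HomologicalComplex.homologyMap_zero]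

variable (M) in
/-- The identification of `M` with `K⁰(y; M) = Hom_R(⋀⁰ Rˢ, M)`. -/
noncomputable def koszulZeroEquiv : M ≃ₗ[R] (⋀[R]^0 (Fin s → R) →ₗ[R] M) :=
  (LinearMap.ringLmapEquivSelf R R M).symm ≪≫ₗ
    (exteriorPower.zeroEquiv R (Fin s → R)).symm.congrLeft M R

theorem lcomp_koszulD_koszulZeroEquiv {m : M} (hm : m ∈ Submodule.torsionBySet R M (Set.range y)) :
    LinearMap.lcomp R M (koszulD y 0) (koszulZeroEquiv M m) = 0 := by
  apply exteriorPower.linearMap_ext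
  ext1 v
  have form_smul : koszulForm y (v 0) • m = 0 := by
    rw [koszulForm, Fintype.linearCombination_apply, Finset.sum_smul]
    refine Finset.sum_eq_zero fun i _ => ?_
    rw [smul_assoc, (Submodule.mem_torsionBySet_iff _ _).mp hm ⟨y i, i, rfl⟩, smul_zero]
  simp [koszulD_ιMulti, koszulZeroEquiv, form_smul]

theorem exists_mono_torsionBySet_homology_zero :
    ∃ f : ModuleCat.of R (Submodule.torsionBySet R M (Set.range y)) ⟶
      (koszulCochainComplex y M).homology 0, Mono f := by
  let k : ModuleCat.of R (Submodule.torsionBySet R M (Set.range y)) ⟶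
      (koszulCochainComplex y M).X 0 :=
    ModuleCat.ofHom ((koszulZeroEquiv M).toLinearMap ∘ₗ Submodule.subtype _)
  have mono_k : Mono k := (ModuleCat.mono_iff_injective k).mpr
    ((koszulZeroEquiv M).injective.comp (Submodule.subtype_injective _))
  have k_d : k ≫ (koszulCochainComplex y M).d 0 1 = 0 := by
    rw [koszulCochainComplex_d]
    ext m
    exact lcomp_koszulD_koszulZeroEquiv y m.2
  let c := (koszulCochainComplex y M).liftCycles k 1 (by simp) k_d
  have : Mono c := by
    have : Mono (c ≫ (koszulCochainComplex y M).iCycles 0) := by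
      rwa [HomologicalComplex.liftCycles_i]
    exact mono_of_mono c ((koszulCochainComplex y M).iCycles 0)
  exact ⟨c ≫ (koszulCochainComplex y M).homologyπ 0, inferInstance⟩

end Koszul

section SerreClass

open HomologicalComplex

theorem monoModSerre_of_exact {C : Type*} [Category* C] [Abelian C] {P : ObjectProperty C}
    [P.IsSerreClass] {S : ShortComplex C} (hS : S.Exact) (h : P S.X₁) : P.monoModSerre S.g :=
  have := hS.epi_kernelLift
  P.prop_of_epi (Limits.kernel.lift S.g S.f S.zero) h

theorem mono_homologyMap_zero {C : Type*} [Category* C] [Abelian C] {K L : CochainComplex C ℕ}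
    (f : K ⟶ L) [Mono f] : Mono (homologyMap f 0) := by
  have : Mono (K.homologyπ 0 ≫ homologyMap f 0) := by
    rw [homologyπ_naturality]
    infer_instance
  exact (mono_comp_iff_of_isIso (K.homologyπ 0) _).mp this

theorem monoModSerre_homologyMap_f {C : Type*} [Category* C] [Abelian C] {P : ObjectProperty C}
    [P.IsSerreClass] {S : ShortComplex (CochainComplex C ℕ)} (hS : S.ShortExact) (i : ℕ)
    (h : ∀ j < i, P (S.X₃.homology j)) : P.monoModSerre (homologyMap S.f i) := by
  cases i with
  | zero =>
    have := hS.mono_f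
    have := mono_homologyMap_zero S.f
    exact P.monoModSerre_of_mono _
  | succ i => exact monoModSerre_of_exact (hS.homology_exact₁ i (i + 1) rfl) (h i i.lt_succ_self)

variable {R : Type u} [CommRing R] {T : ObjectProperty (ModuleCat.{u} R)}
  {M N : Type u} [AddCommGroup M] [Module R M] [AddCommGroup N] [Module R N]

theorem prop_of_injective [T.IsClosedUnderSubobjects] {f : M →ₗ[R] N} (hf : Function.Injective f)
    (h : T (ModuleCat.of R N)) : T (ModuleCat.of R M) :=
  have : Mono (ModuleCat.ofHom f) := (ModuleCat.mono_iff_injective _).mpr hf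
  T.prop_of_mono (ModuleCat.ofHom f) h

theorem prop_of_surjective [T.IsClosedUnderQuotients] {f : M →ₗ[R] N}
    (hf : Function.Surjective f) (h : T (ModuleCat.of R M)) : T (ModuleCat.of R N) :=
  have : Epi (ModuleCat.ofHom f) := (ModuleCat.epi_iff_surjective _).mpr hf
  T.prop_of_epi (ModuleCat.ofHom f) h

theorem prop_iff_of_linearEquiv [T.IsClosedUnderIsomorphisms] (e : M ≃ₗ[R] N) :
    T (ModuleCat.of R M) ↔ T (ModuleCat.of R N) :=
  T.prop_iff_of_iso e.toModuleIso

theorem prop_finArrow [T.IsSerreClass] (h : T (ModuleCat.of R M)) (n : ℕ) :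
    T (ModuleCat.of R (Fin n → M)) := by
  induction n with
  | zero => exact T.prop_of_isZero (ModuleCat.isZero_of_subsingleton _)
  | succ n ih =>
    exact (prop_iff_of_linearEquiv (Fin.consLinearEquiv R fun _ => M)).mp
      (T.prop_of_iso (ModuleCat.biprodIsoProd _ _) (T.prop_biprod h ih))

theorem prop_linearMap [T.IsSerreClass] (F : Type u) [AddCommGroup F] [Module R F]
    [Module.Finite R F] (h : T (ModuleCat.of R M)) : T (ModuleCat.of R (F →ₗ[R] M)) := by
  obtain ⟨n, π, hπ⟩ := Module.Finite.exists_fin' R F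
  exact prop_of_injective (LinearMap.lcomp_injective_of_surjective π hπ)
    ((prop_iff_of_linearEquiv (Module.piEquiv (Fin n) R M)).mp (prop_finArrow h n))

end SerreClass

section KoszulGrade

open HomologicalComplex
open scoped Pointwise

variable {R : Type u} [CommRing R] {T : ObjectProperty (ModuleCat.{u} R)}
  {s : ℕ} {y : Fin s → R}

theorem natCast_le_koszulGrade_iff {M : Type u} [AddCommGroup M] [Module R M] {l : ℕ} :
    (l : ℕ∞) ≤ koszulGrade T y M ↔ ∀ i < l, T ((koszulCochainComplex y M).homology i) := by
  simp only [koszulGrade, le_sInf_iff, Set.mem_ofPred_eq, forall_exists_index, and_imp]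
  constructor
  · intro h i hi
    by_contra hT
    exact hi.not_ge (Nat.cast_le.mp (h _ i hT rfl))
  · rintro h _ i hT rfl
    exact Nat.cast_le.mpr (not_lt.mp fun hi => hT (h i hi))

theorem koszulGrade_congr [T.IsClosedUnderIsomorphisms] {M N : Type u} [AddCommGroup M]
    [Module R M] [AddCommGroup N] [Module R N] (e : M ≃ₗ[R] N) :
    koszulGrade T y M = koszulGrade T y N := by
  have prop_homology_iff (i : ℕ) : T ((koszulCochainComplex y M).homology i) ↔
      T ((koszulCochainComplex y N).homology i) :=
    T.prop_iff_of_iso (homologyMapIso ((koszulFunctor y).mapIso e.toModuleIso) i)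
  simp only [koszulGrade, prop_homology_iff]

variable [T.IsSerreClass] {M : Type u} [AddCommGroup M] [Module R M]

theorem prop_homology_koszulCochainComplex (h : T (ModuleCat.of R M)) (i : ℕ) :
    T ((koszulCochainComplex y M).homology i) :=
  have hX : T (ModuleCat.of R (⋀[R]^i (Fin s → R) →ₗ[R] M)) := prop_linearMap _ h
  T.prop_of_epi ((koszulCochainComplex y M).homologyπ i)
    (T.prop_of_mono ((koszulCochainComplex y M).iCycles i) hX)

variable {x : R}

theorem forall_prop_homology_quotSMulTop_iff (hx : x ∈ Ideal.span (Set.range y))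
    (h : T (ModuleCat.of R (Submodule.torsionBy R M x))) {l : ℕ} :
    (∀ i < l, T ((koszulCochainComplex y (QuotSMulTop x M)).homology i)) ↔
      ∀ i < l + 1, T ((koszulCochainComplex y M).homology i) := by
  let g := (x • ⊤ : Submodule R M).mkQ
  have exact_lsmul : Function.Exact (LinearMap.lsmul R M x) g :=
    LinearMap.exact_lsmul_mkQ_smul_top M x
  -- Multiplication by `x` factors as the surjection `q : M → xM` followed by `j : xM → M`.
  let q := (LinearMap.lsmul R M x).codRestrict (LinearMap.ker g) exact_lsmul.apply_apply_eq_zero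
  let j := (LinearMap.ker g).subtype
  have q_surjective : Function.Surjective q := fun ⟨m, hm⟩ =>
    let ⟨a, ha⟩ := (exact_lsmul m).mp hm
    ⟨a, Subtype.ext ha⟩
  have ker_q : LinearMap.ker q = Submodule.torsionBy R M x := LinearMap.ker_codRestrict ..
  have prop_ker_q (i : ℕ) : T ((koszulCochainComplex y (LinearMap.ker q)).homology i) :=
    prop_homology_koszulCochainComplex (by rwa [ker_q]) i
  have hq := shortExact_map_koszulFunctor y (LinearMap.shortExact_shortComplexKer q_surjective)
  have hj := shortExact_map_koszulFunctor y
    (LinearMap.shortExact_shortComplexKer (Submodule.mkQ_surjective (x • ⊤ : Submodule R M)))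
  constructor
  · intro hQ i hi
    have homologyMap_comp_eq_zero :
        homologyMap (koszulMap y q) i ≫ homologyMap (koszulMap y j) i = 0 := by
      rw [← homologyMap_comp]
      exact homologyMap_koszulMap_lsmul y hx i
    rw [← T.monoModSerre_zero_iff, ← homologyMap_comp_eq_zero]
    exact T.monoModSerre.comp_mem _ _ (monoModSerre_of_exact (hq.homology_exact₂ i) (prop_ker_q i))
      (monoModSerre_homologyMap_f hj i fun k hk => hQ k (by omega))
  · intro hM i hi
    have prop_smul_top : T ((koszulCochainComplex y (LinearMap.ker g)).homology (i + 1)) :=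
      T.prop_X₂_of_exact (hq.homology_exact₃ (i + 1) (i + 2) rfl) (hM (i + 1) (by omega))
        (prop_ker_q (i + 2))
    exact T.prop_X₂_of_exact (hj.homology_exact₃ i (i + 1) rfl) (hM i (by omega)) prop_smul_top

theorem koszulGrade_quotSMulTop_add_one (hx : x ∈ Ideal.span (Set.range y))
    (h : T (ModuleCat.of R (Submodule.torsionBy R M x))) :
    koszulGrade T y (QuotSMulTop x M) + 1 = koszulGrade T y M := by
  refine ENat.eq_of_forall_natCast_le_iff fun l => ?_
  cases l with
  | zero => simp
  | succ l =>
    rw [natCast_le_koszulGrade_iff, ← forall_prop_homology_quotSMulTop_iff hx h,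
      ← natCast_le_koszulGrade_iff, Nat.cast_succ, ENat.add_le_add_iff_right ENat.one_ne_top]

end KoszulGrade

section WeaklyAssociatedPrimes

variable {R : Type u} [CommRing R] {T : ObjectProperty (ModuleCat.{u} R)}
  {M : Type u} [AddCommGroup M] [Module R M] {p : Ideal R}

theorem isPrime_of_mem_weaklyAssociatedPrimes (hp : p ∈ weaklyAssociatedPrimes R M) : p.IsPrime :=
  let ⟨_, hm⟩ := hp
  hm.1.1

theorem mem_weaklyAssociatedPrimes_submodule {N : Submodule R M} :
    p ∈ weaklyAssociatedPrimes R N ↔ ∃ m ∈ N, p ∈ (Ideal.torsionOf R M m).minimalPrimes := by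
  have torsionOf_coe (m : N) : Ideal.torsionOf R N m = Ideal.torsionOf R M m := by
    ext r
    simp [Subtype.ext_iff]
  simp [weaklyAssociatedPrimes, torsionOf_coe]

theorem exists_mul_pow_mem_of_mem_minimalPrimes {I : Ideal R} (hp : p ∈ I.minimalPrimes)
    {x : R} (hx : x ∈ p) : ∃ n : ℕ, ∃ c ∉ p, c * x ^ n ∈ I := by
  have : p.IsPrime := hp.1.1
  by_contra! h
  have hd : Disjoint (I : Set R) (p.primeCompl ⊔ Submonoid.powers x : Submonoid R) := by
    refine Set.disjoint_left.mpr fun z hz hz' => ?_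
    obtain ⟨c, hc, _, ⟨n, rfl⟩, rfl⟩ := Submonoid.mem_sup.mp hz'
    exact h n c hc hz
  obtain ⟨q, hq, hIq, hqd⟩ := Ideal.exists_le_prime_disjoint I _ hd
  have hqp : q ≤ p := fun z hz => by
    by_contra hzp
    exact Set.disjoint_left.mp hqd hz (SetLike.le_def.mp le_sup_left hzp)
  exact Set.disjoint_left.mp hqd (hp.2 ⟨hq, hIq⟩ hqp hx)
    (SetLike.le_def.mp le_sup_right (Submonoid.mem_powers x))

theorem exists_smul_mem_minimalPrimes_torsionOf {M : Type*} [AddCommGroup M] [Module R M] {m : M}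
    (hp : p ∈ (Ideal.torsionOf R M m).minimalPrimes) {x : R} (hx : x ∈ p) :
    ∃ r : R, p ∈ (Ideal.torsionOf R M (r • m)).minimalPrimes ∧ x • r • m = 0 := by
  classical
  have : p.IsPrime := hp.1.1
  obtain ⟨_ | n, ⟨c, hcp, hc⟩, hmin⟩ := Nat.findX (exists_mul_pow_mem_of_mem_minimalPrimes hp hx)
  · rw [pow_zero, mul_one] at hc
    exact absurd (hp.1.2 hc) hcp
  refine ⟨c * x ^ n, ⟨⟨this, fun r hr => ?_⟩, fun q hq hqp => hp.2 ⟨hq.1, fun r hr => ?_⟩ hqp⟩, ?_⟩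
  · by_contra hrp
    rw [Ideal.mem_torsionOf_iff, smul_smul, ← mul_assoc] at hr
    exact hmin n n.lt_succ_self ⟨r * c, Ideal.IsPrime.mul_notMem this hrp hcp, hr⟩
  · refine hq.2 ?_
    rw [Ideal.mem_torsionOf_iff] at hr ⊢
    rw [smul_comm, hr, smul_zero]
  · rwa [smul_smul, mul_left_comm, ← pow_succ']

theorem mem_weaklyAssociatedPrimes_torsionBySet {t : Set R} (ht : t.Finite) (htp : t ⊆ p)
    (hp : p ∈ weaklyAssociatedPrimes R M) :
    p ∈ weaklyAssociatedPrimes R (Submodule.torsionBySet R M t) := by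
  rw [mem_weaklyAssociatedPrimes_submodule]
  induction t, ht using Set.Finite.induction_on with
  | empty =>
    obtain ⟨m, hm⟩ := hp
    exact ⟨m, by simp, hm⟩
  | @insert x t _ _ ih =>
    obtain ⟨hx, ht⟩ := Set.insert_subset_iff.mp htp
    obtain ⟨m, hm, hpm⟩ := ih ht
    obtain ⟨r, hpr, hxr⟩ := exists_smul_mem_minimalPrimes_torsionOf hpm hx
    refine ⟨r • m, ?_, hpr⟩
    have hrm := Submodule.smul_mem _ r hm
    simp only [Submodule.mem_torsionBySet_iff, Subtype.forall] at hrm ⊢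
    exact Set.forall_mem_insert.mpr ⟨hxr, hrm⟩

theorem exists_mem_weaklyAssociatedPrimes_le {q : PrimeSpectrum R} (hq : q ∈ Module.support R M) :
    ∃ p ∈ weaklyAssociatedPrimes R M, p ≤ q.asIdeal := by
  obtain ⟨m, hm⟩ := Module.mem_support_iff'.mp hq
  have torsionOf_le : Ideal.torsionOf R M m ≤ q.asIdeal := fun r hr => by
    by_contra hrq
    exact hm r hrq hr
  obtain ⟨p, hp, hpq⟩ := Ideal.exists_minimalPrimes_le torsionOf_le
  exact ⟨p, ⟨m, hp⟩, hpq⟩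

theorem IsHalfCentered.prop_of_forall_weaklyAssociatedPrimes [T.IsClosedUnderQuotients]
    (hc : IsHalfCentered T)
    (h : ∀ p ∈ weaklyAssociatedPrimes R M, T (ModuleCat.of R (R ⧸ p))) : T (ModuleCat.of R M) := by
  refine hc _ fun q hq => ?_
  obtain ⟨p, hp, hpq⟩ := exists_mem_weaklyAssociatedPrimes_le hq
  exact prop_of_surjective (Submodule.factor_surjective hpq) (h p hp)

theorem prop_quotient_of_mem_weaklyAssociatedPrimes [T.IsClosedUnderSubobjects]
    [T.IsClosedUnderQuotients] (h : T (ModuleCat.of R M)) (hp : p ∈ weaklyAssociatedPrimes R M) :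
    T (ModuleCat.of R (R ⧸ p)) := by
  obtain ⟨m, hm⟩ := hp
  have span_singleton : T (ModuleCat.of R (R ∙ m)) :=
    prop_of_injective (Submodule.subtype_injective _) h
  have : T (ModuleCat.of R (R ⧸ Ideal.torsionOf R M m)) :=
    (prop_iff_of_linearEquiv (Ideal.quotTorsionOfEquivSpanSingleton R M m)).mpr span_singleton
  exact prop_of_surjective (Submodule.factor_surjective hm.1.2) this

theorem exists_mem_span_prop_torsionBy [T.IsClosedUnderSubobjects] [T.IsClosedUnderQuotients]
    (hc : IsHalfCentered T) {t : Set R} (ht : t.Finite)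
    (hM : {p ∈ weaklyAssociatedPrimes R M | ¬ T (ModuleCat.of R (R ⧸ p))}.Finite)
    (h : T (ModuleCat.of R (Submodule.torsionBySet R M t))) :
    ∃ x ∈ Ideal.span t, T (ModuleCat.of R (Submodule.torsionBy R M x)) := by
  have not_subset_union : ¬ ((Ideal.span t : Ideal R) : Set R) ⊆
      ⋃ p ∈ {p ∈ weaklyAssociatedPrimes R M | ¬ T (ModuleCat.of R (R ⧸ p))},
        ((id p : Ideal R) : Set R) := by
    rw [Ideal.subset_union_prime_finite hM (f := id) ⊥ ⊥
      fun p hp _ _ => isPrime_of_mem_weaklyAssociatedPrimes hp.1]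
    rintro ⟨p, ⟨hp, hpT⟩, hle⟩
    exact hpT (prop_quotient_of_mem_weaklyAssociatedPrimes h
      (mem_weaklyAssociatedPrimes_torsionBySet ht (Ideal.subset_span.trans hle) hp))
  obtain ⟨x, hx, hx_notMem⟩ := Set.not_subset.mp not_subset_union
  refine ⟨x, hx, hc.prop_of_forall_weaklyAssociatedPrimes fun p hp => ?_⟩
  obtain ⟨m, hm, hpm⟩ := mem_weaklyAssociatedPrimes_submodule.mp hp
  by_contra hpT
  exact hx_notMem (Set.mem_biUnion (x := p) ⟨⟨m, hpm⟩, hpT⟩ (hpm.1.2 hm))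

end WeaklyAssociatedPrimes

section WeaklyRegularSeq

open scoped Pointwise

variable {R : Type u} [CommRing R] {M : Type u} [AddCommGroup M] [Module R M]

theorem prop_colonElem_quotient_iff {T : ObjectProperty (ModuleCat.{u} R)}
    [T.IsClosedUnderIsomorphisms] {N : Submodule R M} {x : R} :
    T (ModuleCat.of R (colonElem N x ⧸ N.submoduleOf (colonElem N x))) ↔
      T (ModuleCat.of R (Submodule.torsionBy R (M ⧸ N) x)) := by
  let f : colonElem N x →ₗ[R] Submodule.torsionBy R (M ⧸ N) x :=
    (N.mkQ ∘ₗ (colonElem N x).subtype).codRestrict _ fun m =>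
      (Submodule.Quotient.mk_eq_zero N).mpr m.2
  have surjective_f : Function.Surjective f := fun ⟨m, hm⟩ => by
    obtain ⟨m, rfl⟩ := N.mkQ_surjective m
    exact ⟨⟨m, (Submodule.Quotient.mk_eq_zero N).mp hm⟩, rfl⟩
  have ker_f : LinearMap.ker f = N.submoduleOf (colonElem N x) :=
    (LinearMap.ker_codRestrict ..).trans
      (congrArg (Submodule.comap _) N.ker_mkQ)
  rw [← ker_f]
  exact prop_iff_of_linearEquiv (f.quotKerEquivOfSurjective surjective_f)

theorem isWeaklyRegularSeq_concat_iff {T : ObjectProperty (ModuleCat.{u} R)}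
    [T.IsClosedUnderIsomorphisms] {rs : List R} {x : R} :
    IsWeaklyRegularSeq T M (rs ++ [x]) ↔ IsWeaklyRegularSeq T M rs ∧
      T (ModuleCat.of R
        (Submodule.torsionBy R (M ⧸ (Ideal.ofList rs • ⊤ : Submodule R M)) x)) := by
  simp only [IsWeaklyRegularSeq, prop_colonElem_quotient_iff, List.length_append,
    List.length_singleton]
  refine ⟨fun h => ⟨fun i hi => ?_, ?_⟩, fun ⟨h, hx⟩ i hi => ?_⟩
  · have := h i (by omega)
    rwa [List.take_append_of_le_length hi.le, List.getElem_append_left hi] at this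
  · have := h rs.length (by omega)
    rwa [List.take_left, List.getElem_concat_length rfl] at this
  · obtain hi | rfl := Nat.lt_succ_iff_lt_or_eq.mp hi
    · rw [List.take_append_of_le_length hi.le, List.getElem_append_left hi]
      exact h i hi
    · rwa [List.take_left, List.getElem_concat_length rfl]

/-- The isomorphism `M / (x₁, …, xᵣ, x)M ≅ L / xL` for `L = M / (x₁, …, xᵣ)M`. -/
def quotOfListConcatEquiv (M : Type*) [AddCommGroup M] [Module R M] (rs : List R) (x : R) :
    (M ⧸ (Ideal.ofList (rs ++ [x]) • ⊤ : Submodule R M)) ≃ₗ[R]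
      QuotSMulTop x (M ⧸ (Ideal.ofList rs • ⊤ : Submodule R M)) :=
  Submodule.quotEquivOfEq _ _
      (by rw [Ideal.ofList_append, sup_comm, Ideal.ofList_singleton, Ideal.ofList_cons]) ≪≫ₗ
    Submodule.quotOfListConsSMulTopEquivQuotSMulTopOuter M x rs

variable {T : ObjectProperty (ModuleCat.{u} R)} [T.IsSerreClass] {s : ℕ} {y : Fin s → R}

theorem koszulGrade_quot_ofList_add_length {rs : List R}
    (hrs : ∀ x ∈ rs, x ∈ Ideal.span (Set.range y)) (h : IsWeaklyRegularSeq T M rs) :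
    koszulGrade T y (M ⧸ (Ideal.ofList rs • ⊤ : Submodule R M)) + rs.length =
      koszulGrade T y M := by
  induction rs using List.reverseRecOn with
  | nil =>
    have ofList_nil : (Ideal.ofList ([] : List R) • ⊤ : Submodule R M) = ⊥ := by simp
    rw [List.length_nil, Nat.cast_zero, add_zero]
    exact koszulGrade_congr (Submodule.quotEquivOfEqBot _ ofList_nil)
  | append_singleton rs x ih =>
    obtain ⟨h, hx⟩ := isWeaklyRegularSeq_concat_iff.mp h
    rw [← ih (fun z hz => hrs z (List.mem_append_left _ hz)) h,
      ← koszulGrade_quotSMulTop_add_one (hrs x List.mem_concat_self) hx,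
      koszulGrade_congr (quotOfListConcatEquiv M rs x), List.length_append, List.length_singleton,
      Nat.cast_add, Nat.cast_one, add_assoc, add_comm (1 : ℕ∞)]

theorem exists_isWeaklyRegularSeq_of_le_koszulGrade (hc : IsHalfCentered T)
    (hM : ∀ I : Ideal R, I.FG → I ≤ Ideal.span (Set.range y) →
      {p ∈ weaklyAssociatedPrimes R (M ⧸ (I • ⊤ : Submodule R M)) |
        ¬ T (ModuleCat.of R (R ⧸ p))}.Finite)
    {l : ℕ} (hl : (l : ℕ∞) ≤ koszulGrade T y M) :
    ∃ rs : List R, (∀ x ∈ rs, x ∈ Ideal.span (Set.range y)) ∧ IsWeaklyRegularSeq T M rs ∧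
      rs.length = l := by
  induction l with
  | zero => exact ⟨[], by simp, fun i hi => by simp at hi, rfl⟩
  | succ l ih =>
    obtain ⟨rs, hrs, hreg, rfl⟩ := ih ((Nat.cast_le.mpr l.le_succ).trans hl)
    let L := M ⧸ (Ideal.ofList rs • ⊤ : Submodule R M)
    have one_le : ((1 : ℕ) : ℕ∞) ≤ koszulGrade T y L := by
      rw [← koszulGrade_quot_ofList_add_length hrs hreg, Nat.cast_succ, add_comm] at hl
      exact (ENat.add_le_add_iff_right (ENat.natCast_ne_top _)).mp hl
    obtain ⟨f, _⟩ := exists_mono_torsionBySet_homology_zero (y := y) (M := L)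
    have prop_torsionBySet := T.prop_of_mono f (natCast_le_koszulGrade_iff.mp one_le 0 one_pos)
    obtain ⟨x, hx, hxT⟩ := exists_mem_span_prop_torsionBy hc (Set.finite_range y)
      (hM _ (Submodule.fg_span rs.finite_toSet) (Ideal.span_le.mpr hrs)) prop_torsionBySet
    exact ⟨rs ++ [x], by simpa [or_imp, forall_and] using ⟨hrs, hx⟩,
      isWeaklyRegularSeq_concat_iff.mpr ⟨hreg, hxT⟩, by simp⟩

end WeaklyRegularSeq

end TorsionGrade

theorem theorem4p7_general {R : Type u} [CommRing R] {T : ObjectProperty (ModuleCat.{u} R)}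
    [T.IsSerreClass] (hc : TorsionGrade.IsHalfCentered T) {s : ℕ} (y : Fin s → R)
    (M : Type u) [AddCommGroup M] [Module R M]
    (hM : ∀ I : Ideal R, I.FG → I ≤ Ideal.span (Set.range y) →
      {p ∈ TorsionGrade.weaklyAssociatedPrimes R (M ⧸ (I • ⊤ : Submodule R M)) |
        ¬ T (ModuleCat.of R (R ⧸ p))}.Finite) :
    TorsionGrade.classicalGrade T (Ideal.span (Set.range y)) M =
      TorsionGrade.koszulGrade T y M := by
  apply le_antisymm
  · refine sSup_le ?_
    rintro _ ⟨rs, hrs, hreg, rfl⟩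
    rw [← TorsionGrade.koszulGrade_quot_ofList_add_length hrs hreg]
    exact le_add_self
  · refine ENat.forall_natCast_le_iff_le.mp fun l hl => ?_
    obtain ⟨rs, hrs, hreg, rfl⟩ :=
      TorsionGrade.exists_isWeaklyRegularSeq_of_le_koszulGrade hc hM hl
    exact le_sSup ⟨rs, hrs, hreg, rfl⟩

theorem theorem4p7 {R : Type u} [CommRing R]
    (T : ObjectProperty (ModuleCat.{u} R))
    (hT : TorsionGrade.IsTorsionTheory T) (hc : TorsionGrade.IsHalfCentered T)
    (a : Ideal R) (s : ℕ) (y : Fin s → R) (hy : Ideal.span (Set.range y) = a)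
    (M : Type u) [AddCommGroup M] [Module R M]
    (hM : TorsionGrade.IsWeaklyLaskerian R M) :
    TorsionGrade.classicalGrade T a M = TorsionGrade.koszulGrade T y M := by
  subst hy
  have := hT.toIsSerreClass
  exact theorem4p7_general hc y M fun I _ _ => (hM (I • ⊤)).subset (Set.sep_subset _ _)
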